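/- **Proposition 4.** A parallel affine routing problem $G$ consists of finitely many parallel edges $e$ joining one origin to one destination, with latency functions $\ell_e(x)=a_e x+b_e$, $a_e,b_e\ge 0$, and a population $N=[0,r]$ (with Lebesgue measure, $r>0$) of non-atomic users. A flow $f=(f_e)_e$, $f_e\ge 0$, $\sum_e f_e=r$, has total latency $\mathcal L(f)=\sum_e f_e\,\ell_e(f_e)$, and $\mathcal L^{\rm opt}(G)$ is its minimum over all such flows. Given sensitivities $s:N\to(0,\infty)$ and incentive functions $\tau_e$, a Nash flow is a flow induced by a (measurable) choice of an edge for each user such that every user $x$ is on an edge that minimizes $\ell_e(f_e)+s_x\tau_e(f_e)$. Let $\mathcal G^{\rm pa}$ be the class of parallel affine routing problems that have a Nash flow without incentives with positive traffic on every edge. Let $0<S_L\le S_U$ and let $\mathcal S$ be the set of all sensitivity distributions $s:N\to[S_L,S_U]$. For a mechanism $T$ that assigns an incentive function to each affine latency function, let $$\mathrm{PoA}(G,\mathcal S,T)=\sup_{s\in\mathcal S}\frac{\mathcal L^{\rm Nash}(G,s,T)}{\mathcal L^{\rm opt}(G)},\qquad \mathrm{PoA}(\mathcal G^{\rm pa},\mathcal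 S,T)=\sup_{G\in\mathcal G^{\rm pa}}\mathrm{PoA}(G,\mathcal S,T),$$ where $\mathcal L^{\rm Nash}(G,s,T)$ is the highest total latency of a Nash flow (and $0/0:=0$). Let $T^-(k_1,k_2)$ denote the affine subsidy mechanism that assigns $\tau_e(x)=k_1a_ex+k_2b_e$. For any $\beta>0$, the pair $$k_1^*=0,\qquad k_2^*=-\min\Big\{\beta,\frac1{S_L+S_U}\Big\}$$ satisfies $$(k_1^*,k_2^*)\in\operatorname*{arg\,min}_{-\beta\le k_1,k_2\le 0}\mathrm{PoA}\big(\mathcal G^{\rm pa},\mathcal S,T^-(k_1,k_2)\big),$$ and it is the only minimizer if $S_L<S_U$ or $\beta\le\frac1{S_L+S_U}$. Furthermore, for every $G\in\mathcal G^{\rm pa}$, $\mathrm{PoA}(G,\mathcal S,T^-(k_1^*,k_2^*))$ is at most $$\frac43\big(1-\beta S_L(1-\beta S_L)\big)\ \text{ if }\beta<\frac1{S_L+S_U},\qquad \frac43\Big(1-\frac{S_L/S_U}{(1+S_L/S_U)^2}\Big)\ \text{ if }\beta\ge\frac1{S_L+S_U}.$$ -/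

import Mathlib

open MeasureTheory Set
open scoped ENNReal

/-- An affine latency function `x ↦ a * x + b` with `a, b ≥ 0`, recorded by its coefficients
(which it determines). -/
structure AffineLatency where
  a : ℝ
  b : ℝ
  a_nonneg : 0 ≤ a
  b_nonneg : 0 ≤ b

namespace AffineLatency

/-- The delay on an edge with latency function `ℓ` that carries traffic of mass `x`. -/
def eval (ℓ : AffineLatency) (x : ℝ) : ℝ := ℓ.a * x + ℓ.b

end AffineLatency

/-- A network-agnostic incentive mechanism on affine latencies: the incentive function assigned to
an edge depends on the latency function of that edge only.  The incentive is added to the cost, so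
it is a toll where it is nonnegative and a subsidy where it is nonpositive. -/
abbrev IncentiveMechanism : Type := AffineLatency → ℝ → ℝ

/-- No incentive. -/
def noIncentive : IncentiveMechanism := fun _ _ => 0

/-- The affine mechanism `T(k₁, k₂)`, which assigns `τ(x) = k₁ a x + k₂ b` to the latency function
`a x + b`. -/
def affineMechanism (k₁ k₂ : ℝ) : IncentiveMechanism := fun ℓ x => k₁ * ℓ.a * x + k₂ * ℓ.b

/-- A routing problem on a parallel network with affine latencies: one origin, one destination,
`n` parallel edges (each of them is a path), and traffic of mass `r > 0`. -/
structure ParallelGame where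
  n : ℕ
  latency : Fin n → AffineLatency
  r : ℝ
  r_pos : 0 < r

namespace ParallelGame

variable (G : ParallelGame)

/-- The non-atomic users: a closed interval of Lebesgue measure `r`. -/
abbrev Users : Type := Icc (0 : ℝ) G.r

/-- Lebesgue measure on the interval of users. -/
noncomputable def userMeasure : Measure G.Users := (volume : Measure ℝ).comap Subtype.val

/-- Feasible flows: the traffic of mass `r` is split among the edges. -/
def IsFeasible (f : Fin G.n → ℝ) : Prop := (∀ e, 0 ≤ f e) ∧ ∑ e, f e = G.r

/-- Total latency of a flow. -/
def totalLatency (f : Fin G.n → ℝ) : ℝ := ∑ e, f e * (G.latency e).eval (f e)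

/-- The cost that a user of sensitivity `σ` observes on edge `e` in the flow `f`. -/
def cost (T : IncentiveMechanism) (σ : ℝ) (f : Fin G.n → ℝ) (e : Fin G.n) : ℝ :=
  (G.latency e).eval (f e) + σ * T (G.latency e) (f e)

/-- `f` is a Nash flow for the mechanism `T` and the users' sensitivities `s`: it is induced by a
choice `P` of an edge for every user (Lebesgue measurable, so that the masses make sense) in which
each user is on an edge of least cost to that user. -/
def IsNashFlow (s : G.Users → ℝ) (T : IncentiveMechanism) (f : Fin G.n → ℝ) : Prop :=
  ∃ P : G.Users → Fin G.n,
    (∀ e, NullMeasurableSet {x | P x = e} G.userMeasure) ∧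
    (∀ e, f e = G.userMeasure.real {x | P x = e}) ∧
    ∀ x e, G.cost T (s x) f (P x) ≤ G.cost T (s x) f e

/-- Every edge has positive traffic in an untolled Nash flow (the sensitivities play no role
without incentives). -/
def FullyUtilized : Prop :=
  ∃ f, G.IsNashFlow (fun _ => 1) noIncentive f ∧ ∀ e, 0 < f e

/-- The total latency of an optimal flow. -/
noncomputable def optLatency : ℝ≥0∞ :=
  ⨅ (f : Fin G.n → ℝ) (_ : G.IsFeasible f), ENNReal.ofReal (G.totalLatency f)

/-- The highest total latency in a Nash flow. -/
noncomputable def nashLatency (s : G.Users → ℝ) (T : IncentiveMechanism) : ℝ≥0∞ :=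
  ⨆ (f : Fin G.n → ℝ) (_ : G.IsNashFlow s T f), ENNReal.ofReal (G.totalLatency f)

/-- The price of anarchy of `T` in the single routing problem `G`, over all sensitivity
distributions with values in `[SL, SU]`. -/
noncomputable def poa (SL SU : ℝ) (T : IncentiveMechanism) : ℝ≥0∞ :=
  ⨆ (s : G.Users → ℝ) (_ : ∀ x, s x ∈ Icc SL SU), G.nashLatency s T / G.optLatency

end ParallelGame

/-- The class of fully utilized parallel affine congestion games. -/
def parallelAffineGames : Set ParallelGame := {G | G.FullyUtilized}

/-- The price of anarchy of `T` over a family of routing problems and all sensitivity distributions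
with values in `[SL, SU]`. -/
noncomputable def familyPoA (𝒢 : Set ParallelGame) (SL SU : ℝ) (T : IncentiveMechanism) : ℝ≥0∞ :=
  ⨆ G ∈ 𝒢, ParallelGame.poa G SL SU T

/-- The pairs `(k₁, k₂)` with `-β ≤ k₁, k₂ ≤ 0` that minimize the price of anarchy of the affine
subsidy mechanism `T(k₁, k₂)` over the fully utilized parallel affine games. -/
def optimalSubsidyCoeffs (SL SU β : ℝ) : Set (ℝ × ℝ) :=
  {k | k ∈ Icc (-β) 0 ×ˢ Icc (-β) 0 ∧
    IsMinOn (fun k : ℝ × ℝ => familyPoA parallelAffineGames SL SU (affineMechanism k.1 k.2))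
      (Icc (-β) 0 ×ˢ Icc (-β) 0) k}

/-! Upper bound: let `x` be the untolled equilibrium, with common delay `lam`, and take `d` of sum
zero with `a d = b - m`. Every feasible `x + u` has total latency `C - ∑ a u (d - u)`, where `C =
lam * r`. With `D = ∑ a d²`, this is at least `C - D / 4`, and `D ≤ C`.

Under the subsidy `-κ b`, a user of sensitivity `s` minimizes `a u - κ s (a d)`. Between two used
edges, the increment of `a u` is therefore between `κ SL` and `κ SU ≤ 1 - κ SL` times that of `a d`.
Averaging the resulting quadratic inequality over pairs of edges (`sum_quadratic_of_pairwise`) gives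
Nash latency at most `C - q (1 - q) D`, with `q = κ SL`. As `D ≤ C`, the ratio is at most `4/3 (1 -
q (1 - q))`.

Lower bound: in Pigou's network with constant delay `b → 1`, homogeneous users who split give the
ratio `4/3 (1 - ρ (1 - ρ))`, where `ρ = (1 + σ k₂) / (1 + σ k₁)`; otherwise it is at least `4/3`.
Testing `σ = SL` and, if needed, `σ = SU` puts some `ρ` outside the open interval `(q, 1 - q)`
(`le_familyPoA_of_subsidy`). The equality cases give uniqueness. -/

/-! ### Finite-sum identities and inequalities -/

/-- A vector of mean zero whose products with the slopes are the free-flow delays up to a common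
shift. It is the direction of the optimal flow as seen from an equilibrium of common delay `lam`. -/
theorem exists_sum_zero_of_common_delay {ι : Type*} [Fintype ι] [Nonempty ι] {a b x : ι → ℝ}
    {lam : ℝ} (ha : ∀ e, 0 ≤ a e) (hx : ∀ e, a e * x e + b e = lam) :
    ∃ (m : ℝ) (d : ι → ℝ), (∀ e, a e * d e = b e - m) ∧ ∑ e, d e = 0 := by
  classical
  by_cases hc : ∃ c, a c = 0
  · obtain ⟨c, hc⟩ := hc
    -- A constant edge absorbs any mass without changing `a d`, so `c` restores the sum to zero.
    refine ⟨lam, fun e => -x e + (∑ i, x i) * (if e = c then 1 else 0), fun e => ?_, ?_⟩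
    · by_cases h : e = c
      · subst h
        have := hx e
        simp only [hc] at this ⊢
        linarith
      · simp only [h, if_false]
        linarith [hx e]
    · rw [Finset.sum_add_distrib, ← Finset.mul_sum]
      simp
  · push Not at hc
    have hpos : ∀ e, 0 < a e := fun e => lt_of_le_of_ne (ha e) (hc e).symm
    have hW : 0 < ∑ e, (a e)⁻¹ :=
      Finset.sum_pos (fun e _ => inv_pos.2 (hpos e)) Finset.univ_nonempty
    refine ⟨(∑ e, b e * (a e)⁻¹) / ∑ e, (a e)⁻¹,
      fun e => (b e - (∑ e, b e * (a e)⁻¹) / ∑ e, (a e)⁻¹) * (a e)⁻¹, fun e => ?_, ?_⟩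
    · field_simp [(hpos e).ne']
    · simp only [sub_mul]
      rw [Finset.sum_sub_distrib, ← Finset.mul_sum, div_mul_cancel₀ _ hW.ne', sub_self]

/-- Two weighted mean-zero families whose increments satisfy a quadratic inequality pairwise satisfy
it on average. -/
theorem sum_quadratic_of_pairwise {ι : Type*} [Fintype ι] [Nonempty ι] {w U D : ι → ℝ} {p : ℝ}
    (hw : ∀ e, 0 < w e) (hU : ∑ e, w e * U e = 0) (hD : ∑ e, w e * D e = 0)
    (h : ∀ i j, p * (D i - D j) ^ 2 ≤ (U i - U j) * ((D i - D j) - (U i - U j))) :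
    p * ∑ e, w e * D e ^ 2 ≤ ∑ e, w e * (U e * (D e - U e)) := by
  have hW : 0 < ∑ e, w e := Finset.sum_pos (fun e _ => hw e) Finset.univ_nonempty
  set X : ι → ℝ := fun e => U e * (D e - U e) - p * D e ^ 2 with hX
  -- Sum over `j` with `i` fixed, then over `i`: the mean-zero hypotheses kill the cross terms.
  have row : ∀ i, 0 ≤ X i * ∑ j, w j + ∑ j, w j * X j := by
    intro i
    have h0 : 0 ≤ ∑ j, w j *
        ((U i - U j) * ((D i - D j) - (U i - U j)) - p * (D i - D j) ^ 2) :=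
      Finset.sum_nonneg fun j _ => mul_nonneg (hw j).le (sub_nonneg.2 (h i j))
    have h1 : ∑ j, w j * ((U i - U j) * ((D i - D j) - (U i - U j)) - p * (D i - D j) ^ 2) =
        X i * ∑ j, w j + ∑ j, w j * X j + (2 * U i - D i) * ∑ j, w j * U j
          + (2 * p * D i - U i) * ∑ j, w j * D j := by
      simp only [Finset.mul_sum, ← Finset.sum_add_distrib, hX]
      exact Finset.sum_congr rfl fun j _ => by ring
    rw [h1, hU, hD] at h0
    linarith
  have h2 : 0 ≤ ∑ i, w i * (X i * ∑ j, w j + ∑ j, w j * X j) :=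
    Finset.sum_nonneg fun i _ => mul_nonneg (hw i).le (row i)
  have h3 : ∑ i, w i * (X i * ∑ j, w j + ∑ j, w j * X j) =
      2 * (∑ j, w j) * ∑ j, w j * X j := by
    simp only [mul_add, Finset.sum_add_distrib, ← mul_assoc, ← Finset.sum_mul]
    ring
  rw [h3] at h2
  have h4 : 0 ≤ ∑ j, w j * X j := nonneg_of_mul_nonneg_right h2 (by positivity)
  have h5 : ∑ j, w j * X j = ∑ e, w e * (U e * (D e - U e)) - p * ∑ e, w e * D e ^ 2 := by
    rw [Finset.mul_sum, ← Finset.sum_sub_distrib]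
    exact Finset.sum_congr rfl fun j _ => by simp only [hX]; ring
  linarith

/-! ### Flows induced by assignments of users -/

namespace ParallelGame

variable {G : ParallelGame}

theorem userMeasure_setOf (p : ℝ → Prop) :
    G.userMeasure {x : G.Users | p x} = volume (Icc 0 G.r ∩ {x | p x}) := by
  rw [userMeasure, (MeasurableEmbedding.subtype_coe measurableSet_Icc).comap_apply]
  congr 1
  ext x
  simp [and_comm]

theorem userMeasure_univ : G.userMeasure univ = ENNReal.ofReal G.r := by
  simpa using userMeasure_setOf (G := G) fun _ => True

instance : IsFiniteMeasure G.userMeasure := ⟨by rw [userMeasure_univ]; exact ENNReal.ofReal_lt_top⟩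

/-- The flow induced by an assignment of users to edges is feasible. -/
theorem isFeasible_of_assignment {P : G.Users → Fin G.n} {f : Fin G.n → ℝ}
    (hP : ∀ e, NullMeasurableSet {x | P x = e} G.userMeasure)
    (hf : ∀ e, f e = G.userMeasure.real {x | P x = e}) : G.IsFeasible f := by
  refine ⟨fun e => hf e ▸ measureReal_nonneg, ?_⟩
  have h : ∑ e, G.userMeasure {x | P x = e} = ENNReal.ofReal G.r := by
    rw [← userMeasure_univ, ← tsum_fintype (L := .unconditional _), ← measure_iUnion₀ _ hP]
    · congr 1
      ext x
      simp
    · intro i j hij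
      refine Disjoint.aedisjoint (Set.disjoint_left.2 fun x hx hx' => hij ?_)
      exact hx.symm.trans hx'
  simp only [hf, measureReal_def]
  rw [← ENNReal.toReal_sum fun e _ => measure_ne_top _ _, h, ENNReal.toReal_ofReal G.r_pos.le]

theorem IsNashFlow.isFeasible {s : G.Users → ℝ} {T : IncentiveMechanism} {f : Fin G.n → ℝ}
    (h : G.IsNashFlow s T f) : G.IsFeasible f := by
  obtain ⟨P, hP, hf, -⟩ := h
  exact isFeasible_of_assignment hP hf

theorem exists_user_of_pos {P : G.Users → Fin G.n} {e : Fin G.n}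
    (h : 0 < G.userMeasure.real {x | P x = e}) : ∃ x, P x = e := by
  by_contra hn
  push Not at hn
  have : {x | P x = e} = ∅ := Set.eq_empty_of_forall_notMem hn
  rw [this] at h
  simp at h

/-- In a fully utilized game all edges share the same delay in some flow with positive traffic
everywhere. -/
theorem FullyUtilized.exists_common_delay (h : G.FullyUtilized) :
    ∃ (x : Fin G.n → ℝ) (lam : ℝ), G.IsFeasible x ∧ (∀ e, 0 < x e) ∧
      ∀ e, (G.latency e).a * x e + (G.latency e).b = lam := by
  obtain ⟨x, hN, hx⟩ := h
  have hfeas := hN.isFeasible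
  obtain ⟨P, -, hf, hc⟩ := hN
  have used : ∀ e, ∃ y, P y = e := fun e => exists_user_of_pos (hf e ▸ hx e)
  simp only [cost, noIncentive, AffineLatency.eval, mul_zero, add_zero] at hc
  let e₀ := P ⟨0, le_rfl, G.r_pos.le⟩
  refine ⟨x, (G.latency e₀).a * x e₀ + (G.latency e₀).b, hfeas, hx, fun e => le_antisymm ?_ ?_⟩
  · obtain ⟨y, hy⟩ := used e
    have := hc y e₀
    rwa [hy] at this
  · exact hc _ e

/-! ### Upper bound on the price of anarchy -/

/-- A lower bound on the optimal total latency, and an upper bound for Nash flows, in terms of the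
same two quantities. -/
theorem FullyUtilized.totalLatency_bounds (hG : G.FullyUtilized) {SL SU κ : ℝ}
    (hSL : 0 < SL) (hκ : 0 < κ) (hκ' : κ * (SL + SU) ≤ 1) :
    ∃ C D : ℝ, 0 ≤ D ∧ D ≤ C ∧ (∀ g, G.IsFeasible g → C - D / 4 ≤ G.totalLatency g) ∧
      ∀ (s : G.Users → ℝ) (f : Fin G.n → ℝ), (∀ x, s x ∈ Icc SL SU) →
        G.IsNashFlow s (affineMechanism 0 (-κ)) f →
          G.totalLatency f ≤ C - κ * SL * (1 - κ * SL) * D := by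
  obtain ⟨x, lam, hxfeas, hx, hlam⟩ := hG.exists_common_delay
  have hne : Nonempty (Fin G.n) := by
    by_contra hempty
    have := hxfeas.2
    rw [not_nonempty_iff] at hempty
    rw [Finset.univ_eq_empty, Finset.sum_empty] at this
    exact G.r_pos.ne this
  set a : Fin G.n → ℝ := fun e => (G.latency e).a with ha_def
  set b : Fin G.n → ℝ := fun e => (G.latency e).b with hb_def
  have ha : ∀ e, 0 ≤ a e := fun e => (G.latency e).a_nonneg
  have hb : ∀ e, 0 ≤ b e := fun e => (G.latency e).b_nonneg
  change ∀ e, a e * x e + b e = lam at hlam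
  obtain ⟨m, d, hd, hdsum⟩ := exists_sum_zero_of_common_delay ha hlam
  have hax : ∀ e, a e * x e = lam - m - a e * d e := fun e => by linarith [hlam e, hd e]
  have hL : ∀ g, G.IsFeasible g → G.totalLatency g =
      lam * G.r - ∑ e, a e * ((g e - x e) * (d e - (g e - x e))) := by
    intro g hg
    have h1 : G.totalLatency g = ∑ e, (lam * g e - a e * ((g e - x e) * (d e - (g e - x e)))
        + (lam - m) * (g e - x e)) := by
      refine Finset.sum_congr rfl fun e _ => ?_
      change g e * (a e * g e + b e) = _
      linear_combination (g e) * hlam e + (g e - x e) * hax e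
    rw [h1, Finset.sum_add_distrib, Finset.sum_sub_distrib, ← Finset.mul_sum, ← Finset.mul_sum,
      Finset.sum_sub_distrib, hg.2, hxfeas.2]
    ring
  refine ⟨lam * G.r, ∑ e, a e * d e ^ 2,
    Finset.sum_nonneg fun e _ => mul_nonneg (ha e) (sq_nonneg _), ?_, ?_, ?_⟩
  -- This nonnegative sum equals `C - D`.
  · have h1 : 0 ≤ ∑ e, (a e * (x e + d e) ^ 2 + b e * x e) := Finset.sum_nonneg fun e _ =>
      add_nonneg (mul_nonneg (ha e) (sq_nonneg _)) (mul_nonneg (hb e) (hx e).le)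
    have h2 : ∑ e, (a e * (x e + d e) ^ 2 + b e * x e) =
        ∑ e, (lam * x e + 2 * (lam - m) * d e - a e * d e ^ 2) :=
      Finset.sum_congr rfl fun e _ => by
        linear_combination (x e) * hlam e + 2 * d e * hax e
    rw [h2, Finset.sum_sub_distrib, Finset.sum_add_distrib, ← Finset.mul_sum, ← Finset.mul_sum,
      hdsum, hxfeas.2] at h1
    linarith
  · intro g hg
    rw [hL g hg, Finset.sum_div]
    gcongr with e
    nlinarith [mul_nonneg (ha e) (sq_nonneg (d e - 2 * (g e - x e)))]
  · rintro s f hs hN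
    have hfeas := hN.isFeasible
    obtain ⟨P, -, hf, hc⟩ := hN
    have hκSU : κ * SU < 1 := by nlinarith
    -- Each user weights the delay of its edge with `γ = 1 - κ * s`.
    have hcost : ∀ y e, a (P y) * f (P y) + (1 - κ * s y) * b (P y) ≤
        a e * f e + (1 - κ * s y) * b e := by
      intro y e
      have := hc y e
      simp only [cost, affineMechanism, AffineLatency.eval] at this
      simp only [ha_def, hb_def]
      linarith
    have hγ0 : ∀ y, 0 < 1 - κ * s y := fun y => by nlinarith [(hs y).2]
    have hγ1 : ∀ y, 0 < κ * s y := fun y => mul_pos hκ (hSL.trans_le (hs y).1)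
    have hzero : ∀ e, (¬ ∃ y, P y = e) → f e = 0 := by
      intro e he
      refine le_antisymm ?_ (hfeas.1 e)
      by_contra hpos
      exact he (exists_user_of_pos (hf e ▸ not_le.1 hpos))
    have not_lt : ¬ ∀ i, f i < x i := by
      intro h
      have := Finset.sum_lt_sum_of_nonempty (Finset.univ_nonempty (α := Fin G.n))
        fun i _ => h i
      rw [hfeas.2, hxfeas.2] at this
      exact lt_irrefl _ this
    -- An empty edge of positive slope would look so cheap that every edge in use would have to
    -- carry less than in `x`, contradicting equal total mass.
    have used : ∀ e, 0 < a e → ∃ y, P y = e := by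
      intro e he
      by_contra hn
      refine not_lt fun i => ?_
      by_cases hi : ∃ y, P y = i
      · obtain ⟨y, rfl⟩ := hi
        have h1 := hcost y e
        rw [hzero e hn, mul_zero, zero_add] at h1
        have h2 : (1 - κ * s y) * b e < (1 - κ * s y) * lam :=
          mul_lt_mul_of_pos_left (by nlinarith [hlam e, mul_pos he (hx e)]) (hγ0 y)
        rw [← hlam (P y)] at h2
        have h3 : a (P y) * f (P y) < a (P y) * x (P y) := by
          nlinarith [mul_nonneg (hγ1 y).le (mul_nonneg (ha (P y)) (hx (P y)).le)]
        exact lt_of_mul_lt_mul_left h3 (ha _)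
      · rw [hzero i hi]
        exact hx i
    -- The same mass count applies: if all constant edges were empty, every edge would carry less
    -- than in `x`.
    have used_const : (∃ c, a c = 0) → ∃ c, a c = 0 ∧ ∃ y, P y = c := by
      rintro ⟨c, hac⟩
      by_contra hn
      push Not at hn
      refine not_lt fun i => ?_
      by_cases hi : ∃ y, P y = i
      · obtain ⟨y, rfl⟩ := hi
        have hai : 0 < a (P y) := (ha _).lt_of_ne fun h => hn _ h.symm y rfl
        have h1 := hcost y c
        have h2 := hlam c
        rw [hac, zero_mul, zero_add] at h1 h2
        rw [h2, ← hlam (P y)] at h1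
        have h3 : a (P y) * f (P y) < a (P y) * x (P y) := by
          nlinarith [mul_pos (hγ1 y) (mul_pos hai (hx (P y)))]
        exact lt_of_mul_lt_mul_left h3 (ha _)
      · rw [hzero i hi]
        exact hx i
    set u : Fin G.n → ℝ := fun e => f e - x e with hu
    have slope : ∀ y e, κ * s y * (a e * d e - a (P y) * d (P y)) ≤ a e * u e - a (P y) * u (P y) := by
      intro y e
      have h1 := hcost y e
      have h2 := hlam e
      have h3 := hlam (P y)
      rw [hd, hd]
      simp only [hu]
      nlinarith
    have pair : ∀ y z, κ * SL * (1 - κ * SL) * (a (P y) * d (P y) - a (P z) * d (P z)) ^ 2 ≤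
        (a (P y) * u (P y) - a (P z) * u (P z)) *
          ((a (P y) * d (P y) - a (P z) * d (P z)) - (a (P y) * u (P y) - a (P z) * u (P z))) := by
      intro y z
      wlog hle : a (P z) * d (P z) ≤ a (P y) * d (P y) generalizing y z
      · have := this z y (le_of_not_ge hle)
        nlinarith
      have h1 := slope z (P y)
      have h2 := slope y (P z)
      have hΔ := sub_nonneg.2 hle
      set Δ := a (P y) * d (P y) - a (P z) * d (P z)
      set V := a (P y) * u (P y) - a (P z) * u (P z)
      have h3 : κ * SL * Δ ≤ V :=
        le_trans (mul_le_mul_of_nonneg_right (mul_le_mul_of_nonneg_left (hs z).1 hκ.le) hΔ) h1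
      have h4 : V ≤ (1 - κ * SL) * Δ := by
        have h5 : V ≤ κ * s y * Δ := by simp only [V, Δ]; linarith
        refine h5.trans (mul_le_mul_of_nonneg_right ?_ hΔ)
        have := mul_le_mul_of_nonneg_left (hs y).2 hκ.le
        linarith
      -- With `q = κ * SL`, the product `(V - q Δ) ((1 - q) Δ - V)` is `V (Δ - V) - q (1 - q) Δ²`.
      nlinarith [mul_nonneg (sub_nonneg.2 h3) (sub_nonneg.2 h4)]
    have key : κ * SL * (1 - κ * SL) * ∑ e, a e * d e ^ 2 ≤ ∑ e, a e * (u e * (d e - u e)) := by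
      by_cases hconst : ∃ c, a c = 0
      -- On a used constant edge both `a u` and `a d` vanish, so comparing with it alone suffices
      -- and no averaging is needed.
      · obtain ⟨_, hac, z, rfl⟩ := used_const hconst
        rw [Finset.mul_sum]
        refine Finset.sum_le_sum fun e _ => ?_
        rcases (ha e).eq_or_lt with h | h
        · simp [← h]
        · obtain ⟨y, rfl⟩ := used e h
          have h1 := pair y z
          simp only [hac, zero_mul, sub_zero] at h1
          refine le_of_mul_le_mul_left ?_ h
          linarith
      · push Not at hconst
        have hpos : ∀ e, 0 < a e := fun e => (ha e).lt_of_ne (hconst e).symm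
        have husum : ∑ e, u e = 0 := by
          simp only [hu]
          rw [Finset.sum_sub_distrib, hfeas.2, hxfeas.2, sub_self]
        -- Weights `1 / a` turn `a u` and `a d` back into `u` and `d`, which sum to zero.
        have h1 := sum_quadratic_of_pairwise (w := fun e => (a e)⁻¹) (U := fun e => a e * u e)
          (D := fun e => a e * d e) (p := κ * SL * (1 - κ * SL)) (fun e => inv_pos.2 (hpos e))
          (by simpa [inv_mul_cancel_left₀ (hconst _)] using husum)
          (by simpa [inv_mul_cancel_left₀ (hconst _)] using hdsum) ?_
        · convert h1 using 2
          · refine Finset.sum_congr rfl fun e _ => ?_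
            have := hconst e
            field_simp
          · have := hconst ‹_›
            field_simp
        · intro i j
          obtain ⟨y, rfl⟩ := used i (hpos i)
          obtain ⟨z, rfl⟩ := used j (hpos j)
          exact pair y z
    rw [hL f hfeas]
    exact sub_le_sub_left key _

/-- With `p = κ SL (1 - κ SL) ≤ 1/4`, the bound `(C - p D) / (C - D / 4)` is largest at `D = C`. -/
theorem FullyUtilized.poa_le (hG : G.FullyUtilized) {SL SU κ : ℝ}
    (hSL : 0 < SL) (hκ : 0 < κ) (hκ' : κ * (SL + SU) ≤ 1) :
    G.poa SL SU (affineMechanism 0 (-κ)) ≤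
      ENNReal.ofReal (4 / 3 * (1 - κ * SL * (1 - κ * SL))) := by
  obtain ⟨C, D, hD, hDC, hopt, hnash⟩ := hG.totalLatency_bounds hSL hκ hκ'
  have hp : κ * SL * (1 - κ * SL) ≤ 1 / 4 := by nlinarith [sq_nonneg (2 * (κ * SL) - 1)]
  refine iSup₂_le fun s hs => ENNReal.div_le_of_le_mul (iSup₂_le fun f hf => ?_)
  have hopt' : ENNReal.ofReal (C - D / 4) ≤ G.optLatency :=
    le_iInf₂ fun g hg => ENNReal.ofReal_le_ofReal (hopt g hg)
  refine le_trans ?_ (mul_le_mul_right hopt' _)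
  rw [← ENNReal.ofReal_mul (by linarith)]
  refine ENNReal.ofReal_le_ofReal ((hnash s f hs hf).trans ?_)
  nlinarith [mul_nonneg (sub_nonneg.2 hp) (sub_nonneg.2 hDC)]

end ParallelGame

/-! ### Lower bounds from Pigou's network -/

/-- Pigou's network: unit traffic and two edges with latency functions `x` and `b`. -/
def pigouGame (b : ℝ) (hb : 0 ≤ b) : ParallelGame where
  n := 2
  latency := ![⟨1, 0, zero_le_one, le_rfl⟩, ⟨0, b, le_rfl, hb⟩]
  r := 1
  r_pos := one_pos

theorem pigouGame_totalLatency {b : ℝ} (hb : 0 ≤ b) (t : ℝ) :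
    (pigouGame b hb).totalLatency ![t, 1 - t] = t ^ 2 + (1 - t) * b := by
  change ∑ e : Fin 2, _ = _
  simp only [Fin.sum_univ_two]
  simp [pigouGame, AffineLatency.eval]
  ring

/-- An equilibrium of Pigou's network for homogeneous users. -/
theorem pigouGame_isNashFlow {b σ t : ℝ} {T : IncentiveMechanism} (hb : 0 ≤ b)
    (ht : t ∈ Icc (0 : ℝ) 1)
    (h₀ : 0 < t → (pigouGame b hb).cost T σ ![t, 1 - t] (0 : Fin 2) ≤
      (pigouGame b hb).cost T σ ![t, 1 - t] (1 : Fin 2))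
    (h₁ : t < 1 → (pigouGame b hb).cost T σ ![t, 1 - t] (1 : Fin 2) ≤
      (pigouGame b hb).cost T σ ![t, 1 - t] (0 : Fin 2)) :
    (pigouGame b hb).IsNashFlow (fun _ => σ) T ![t, 1 - t] := by
  classical
  set G := pigouGame b hb with hG
  -- Equilibrium is required of every user, not almost every one; `0 < t` keeps user `0` off the
  -- first edge when `t = 0`.
  let p : ℝ → Prop := fun y => 0 < t ∧ y ≤ t
  let P : G.Users → Fin 2 := fun y => if p y then 0 else 1
  have hP0 : {y | P y = 0} = {y : G.Users | p y} := by
    ext y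
    simp [P]
  have hP1 : {y | P y = 1} = {y : G.Users | p y}ᶜ := by
    ext y
    simp [P]
  have hmeas : MeasurableSet {y : G.Users | p y} :=
    (MeasurableSet.const _).inter (measurableSet_le measurable_subtype_coe measurable_const)
  have hm0 : G.userMeasure.real {y : G.Users | p y} = t := by
    rw [measureReal_def, ParallelGame.userMeasure_setOf]
    rcases ht.1.eq_or_lt with h | h
    · simp [p, ← h]
    · have : Icc 0 G.r ∩ {y | p y} = Icc 0 t := by
        ext y
        simp only [p, h, true_and, mem_inter_iff, mem_Icc, mem_ofPred_eq]
        exact ⟨fun hy => ⟨hy.1.1, hy.2⟩, fun hy => ⟨⟨hy.1, hy.2.trans ht.2⟩, hy.2⟩⟩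
      rw [this, Real.volume_Icc, sub_zero, ENNReal.toReal_ofReal ht.1]
  have hm1 : G.userMeasure.real {y : G.Users | p y}ᶜ = 1 - t := by
    rw [measureReal_compl hmeas, hm0, measureReal_def, ParallelGame.userMeasure_univ,
      ENNReal.toReal_ofReal G.r_pos.le]
    rfl
  refine ⟨P, ?_, ?_, ?_⟩
  · refine Fin.forall_fin_two.2 ⟨?_, ?_⟩
    · exact hP0 ▸ hmeas.nullMeasurableSet
    · exact hP1 ▸ hmeas.compl.nullMeasurableSet
  · refine Fin.forall_fin_two.2 ⟨?_, ?_⟩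
    · exact (hm0.symm.trans (congrArg _ hP0.symm))
    · exact (hm1.symm.trans (congrArg _ hP1.symm))
  · intro y
    by_cases hy : p y
    · have hPy : P y = 0 := if_pos hy
      rw [hPy]
      exact Fin.forall_fin_two.2 ⟨le_rfl, h₀ hy.1⟩
    · have hPy : P y = 1 := if_neg hy
      rw [hPy]
      refine Fin.forall_fin_two.2 ⟨h₁ ?_, le_rfl⟩
      by_contra hlt
      have h1 : (1 : ℝ) ≤ t := not_lt.1 hlt
      exact hy ⟨by linarith, le_trans y.2.2 h1⟩

theorem pigouGame_mem {b : ℝ} (hb : 0 < b) (hb1 : b < 1) :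
    pigouGame b hb.le ∈ parallelAffineGames := by
  refine ⟨![b, 1 - b], pigouGame_isNashFlow hb.le ⟨hb.le, hb1.le⟩ ?_ ?_,
    Fin.forall_fin_two.2 ⟨hb, sub_pos.2 hb1⟩⟩ <;>
  simp [ParallelGame.cost, pigouGame, AffineLatency.eval, noIncentive]

theorem pigouGame_optLatency_le {b : ℝ} (hb : 0 ≤ b) (hb1 : b ≤ 1) :
    (pigouGame b hb).optLatency ≤ ENNReal.ofReal (b - b ^ 2 / 4) := by
  have hfeas : (pigouGame b hb).IsFeasible ![b / 2, 1 - b / 2] := by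
    constructor
    · refine Fin.forall_fin_two.2 ⟨?_, ?_⟩
      · change 0 ≤ b / 2
        linarith
      · change 0 ≤ 1 - b / 2
        linarith
    · change ∑ e : Fin 2, (![b / 2, 1 - b / 2] : Fin 2 → ℝ) e = (1 : ℝ)
      simp [Fin.sum_univ_two]
  refine (iInf₂_le _ hfeas).trans ?_
  rw [pigouGame_totalLatency]
  exact ENNReal.ofReal_le_ofReal (by nlinarith)

/-- The price of anarchy that a single equilibrium of Pigou's network certifies. -/
theorem le_familyPoA_of_pigou {SL SU b σ t k₁ k₂ : ℝ} (hb : 0 < b) (hb1 : b < 1)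
    (hσ : σ ∈ Icc SL SU) (ht : t ∈ Icc (0 : ℝ) 1)
    (h₀ : 0 < t → (1 + σ * k₁) * t ≤ (1 + σ * k₂) * b)
    (h₁ : t < 1 → (1 + σ * k₂) * b ≤ (1 + σ * k₁) * t) :
    ENNReal.ofReal ((t ^ 2 + (1 - t) * b) / (b - b ^ 2 / 4)) ≤
      familyPoA parallelAffineGames SL SU (affineMechanism k₁ k₂) := by
  have hN : (pigouGame b hb.le).IsNashFlow (fun _ => σ) (affineMechanism k₁ k₂) ![t, 1 - t] := by
    refine pigouGame_isNashFlow hb.le ht (fun h => ?_) fun h => ?_ <;>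
    simp [ParallelGame.cost, pigouGame, AffineLatency.eval, affineMechanism]
    · linarith [h₀ h]
    · linarith [h₁ h]
  rw [ENNReal.ofReal_div_of_pos (by nlinarith), ← pigouGame_totalLatency hb.le]
  refine le_trans ?_ (le_iSup₂_of_le (pigouGame b hb.le) (pigouGame_mem hb hb1)
    (le_iSup₂_of_le (fun _ => σ) (fun _ => hσ) le_rfl))
  exact ENNReal.div_le_div (le_iSup₂_of_le _ hN le_rfl) (pigouGame_optLatency_le hb.le hb1.le)

/-- The worst case `b = 1` is only approached: there the untolled equilibrium leaves the constant
edge empty. -/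
theorem le_familyPoA_of_tendsto_pigou {SL SU σ t₀ k₁ k₂ : ℝ} {t : ℝ → ℝ}
    (hσ : σ ∈ Icc SL SU) (htt : Filter.Tendsto t (nhdsWithin 1 (Iio 1)) (nhds t₀))
    (h : ∀ᶠ b in nhdsWithin (1 : ℝ) (Iio 1), t b ∈ Icc (0 : ℝ) 1 ∧
      (0 < t b → (1 + σ * k₁) * t b ≤ (1 + σ * k₂) * b) ∧
      (t b < 1 → (1 + σ * k₂) * b ≤ (1 + σ * k₁) * t b)) :
    ENNReal.ofReal (4 / 3 * (1 - t₀ * (1 - t₀))) ≤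
      familyPoA parallelAffineGames SL SU (affineMechanism k₁ k₂) := by
  have hid : Filter.Tendsto (fun b : ℝ => b) (nhdsWithin 1 (Iio 1)) (nhds 1) :=
    tendsto_nhdsWithin_of_tendsto_nhds Filter.tendsto_id
  have hlim : Filter.Tendsto (fun b : ℝ => (t b ^ 2 + (1 - t b) * b) / (b - b ^ 2 / 4))
      (nhdsWithin 1 (Iio 1)) (nhds ((t₀ ^ 2 + (1 - t₀) * 1) / (1 - 1 ^ 2 / 4))) :=
    ((htt.pow 2).add ((htt.const_sub 1).mul hid)).div (hid.sub ((hid.pow 2).div_const 4))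
      (by norm_num)
  have heq : (t₀ ^ 2 + (1 - t₀) * 1) / (1 - 1 ^ 2 / 4) = 4 / 3 * (1 - t₀ * (1 - t₀)) := by ring
  rw [heq] at hlim
  refine le_of_tendsto (ENNReal.tendsto_ofReal hlim) ?_
  have hpos : ∀ᶠ b in nhdsWithin (1 : ℝ) (Iio 1), 0 < b :=
    hid.eventually (lt_mem_nhds one_pos)
  filter_upwards [h, hpos, self_mem_nhdsWithin] with b hb hb0 hb1
  exact le_familyPoA_of_pigou hb0 hb1 hσ hb.1 hb.2.1 hb.2.2

/-- The price of anarchy of an affine mechanism is at least `4 / 3`, unless homogeneous users of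
sensitivity `σ` split between the edges of Pigou's network. -/
theorem familyPoA_lower_bound {SL SU σ k₁ k₂ : ℝ} (hσ : σ ∈ Icc SL SU) :
    ENNReal.ofReal (4 / 3) ≤ familyPoA parallelAffineGames SL SU (affineMechanism k₁ k₂) ∨
      ∃ ρ, 0 < ρ ∧ ρ < 1 ∧ 0 < 1 + σ * k₁ ∧ ρ * (1 + σ * k₁) = 1 + σ * k₂ ∧
        ENNReal.ofReal (4 / 3 * (1 - ρ * (1 - ρ))) ≤
          familyPoA parallelAffineGames SL SU (affineMechanism k₁ k₂) := by
  have hid : Filter.Tendsto (fun b : ℝ => b) (nhdsWithin 1 (Iio 1)) (nhds 1) :=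
    tendsto_nhdsWithin_of_tendsto_nhds Filter.tendsto_id
  have hpos : ∀ᶠ b in nhdsWithin (1 : ℝ) (Iio 1), 0 < b :=
    hid.eventually (lt_mem_nhds one_pos)
  rcases le_or_gt (1 + σ * k₂) 0 with h2 | h2
  · left
    have h := le_familyPoA_of_tendsto_pigou (t := fun _ => 0) (k₁ := k₁) (k₂ := k₂) hσ
      tendsto_const_nhds (by
        filter_upwards [hpos] with b hb
        exact ⟨by simp, fun h => absurd h (lt_irrefl _), fun _ => by nlinarith⟩)
    simpa using h
  rcases lt_trichotomy (1 + σ * k₁) (1 + σ * k₂) with h12 | h12 | h12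
  · left
    have hev : ∀ᶠ b in nhdsWithin (1 : ℝ) (Iio 1), 1 + σ * k₁ < (1 + σ * k₂) * b :=
      (hid.const_mul (1 + σ * k₂)).eventually (lt_mem_nhds (by simpa using h12))
    have h := le_familyPoA_of_tendsto_pigou (t := fun _ => 1) (k₁ := k₁) (k₂ := k₂) hσ
      tendsto_const_nhds (by
        filter_upwards [hev] with b hb
        exact ⟨by simp, fun _ => by linarith, fun h => absurd h (lt_irrefl _)⟩)
    simpa using h
  · left
    have h := le_familyPoA_of_tendsto_pigou (t := fun b => b) (k₁ := k₁) (k₂ := k₂) hσ hid (by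
        filter_upwards [hpos, self_mem_nhdsWithin] with b hb hb1
        exact ⟨⟨hb.le, le_of_lt hb1⟩, fun _ => by rw [h12], fun _ => by rw [h12]⟩)
    simpa using h
  · right
    have h1 : 0 < 1 + σ * k₁ := h2.trans h12
    have hmul : (1 + σ * k₂) / (1 + σ * k₁) * (1 + σ * k₁) = 1 + σ * k₂ :=
      div_mul_cancel₀ _ h1.ne'
    have hρ0 := div_pos h2 h1
    have hρ1 := (div_lt_one h1).2 h12
    refine ⟨(1 + σ * k₂) / (1 + σ * k₁), hρ0, hρ1, h1, hmul, ?_⟩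
    set ρ := (1 + σ * k₂) / (1 + σ * k₁)
    refine le_familyPoA_of_tendsto_pigou (t := fun b => ρ * b) hσ
      (by simpa using hid.const_mul ρ) ?_
    filter_upwards [hpos, self_mem_nhdsWithin] with b hb hb1
    have hb1' : b < 1 := hb1
    have heq : (1 + σ * k₁) * (ρ * b) = (1 + σ * k₂) * b := by rw [← hmul]; ring
    exact ⟨⟨by positivity, by nlinarith⟩, fun _ => heq.le, fun _ => heq.ge⟩

/-! ### Optimality and uniqueness of the coefficients -/

/-- No affine subsidy beats a subsidy rate `κ` on the constant part alone that either is the largest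
available one or balances the two extreme sensitivities, and ties are rare. -/
theorem le_familyPoA_of_subsidy {SL SU κ k₁ k₂ : ℝ} (hSL : 0 < SL) (hSU : SL ≤ SU) (hκ : 0 < κ)
    (hκ' : κ * (SL + SU) ≤ 1) (hk₁ : k₁ ≤ 0) (hk : -κ ≤ k₂ ∨ κ * (SL + SU) = 1) :
    ENNReal.ofReal (4 / 3 * (1 - κ * SL * (1 - κ * SL))) ≤
        familyPoA parallelAffineGames SL SU (affineMechanism k₁ k₂) ∧
      (familyPoA parallelAffineGames SL SU (affineMechanism k₁ k₂) ≤
          ENNReal.ofReal (4 / 3 * (1 - κ * SL * (1 - κ * SL))) →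
        (-κ ≤ k₂ ∨ SL < SU) → k₁ = 0 ∧ k₂ = -κ) := by
  set F := familyPoA parallelAffineGames SL SU (affineMechanism k₁ k₂)
  set q := κ * SL with hq_def
  have hq : 0 < q := mul_pos hκ hSL
  have hq2 : q ≤ 1 / 2 := by nlinarith
  have hB : 0 ≤ 4 / 3 * (1 - q * (1 - q)) := by nlinarith
  -- It is enough to exhibit a certified ratio in the right position relative to `q` and `1 - q`.
  have of_ratio : ∀ ρ, ENNReal.ofReal (4 / 3 * (1 - ρ * (1 - ρ))) ≤ F →
      ρ ≤ q ∨ 1 - q ≤ ρ → ENNReal.ofReal (4 / 3 * (1 - q * (1 - q))) ≤ F ∧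
        (F ≤ ENNReal.ofReal (4 / 3 * (1 - q * (1 - q))) → ρ = q ∨ ρ = 1 - q) := by
    intro ρ hF hρ
    have hprod : 0 ≤ (ρ - q) * (ρ - (1 - q)) := by
      rcases hρ with h | h <;> nlinarith
    refine ⟨(ENNReal.ofReal_le_ofReal (by nlinarith)).trans hF, fun hF' => ?_⟩
    have h1 := (ENNReal.ofReal_le_ofReal_iff hB).1 (hF.trans hF')
    have h2 : (ρ - q) * (ρ - (1 - q)) = 0 := le_antisymm (by nlinarith) hprod
    rcases mul_eq_zero.1 h2 with h | h
    · left; linarith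
    · right; linarith
  have of_one : ENNReal.ofReal (4 / 3) ≤ F → ENNReal.ofReal (4 / 3 * (1 - q * (1 - q))) ≤ F ∧
      (F ≤ ENNReal.ofReal (4 / 3 * (1 - q * (1 - q))) → (-κ ≤ k₂ ∨ SL < SU) →
        k₁ = 0 ∧ k₂ = -κ) := by
    intro hF
    obtain ⟨h1, h2⟩ := of_ratio 1 (by simpa using hF) (Or.inr (by linarith))
    exact ⟨h1, fun h _ => by rcases h2 h with h | h <;> linarith⟩
  rcases familyPoA_lower_bound (k₁ := k₁) (k₂ := k₂) (left_mem_Icc.2 hSU) with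
    h | ⟨ρ, hρ0, hρ1, hα, hρ, hF⟩
  · exact of_one h
  by_cases hk₂ : -κ ≤ k₂
  · have h1 : 0 ≤ SL * (κ + k₂) := mul_nonneg hSL.le (by linarith)
    have h2 : 0 ≤ ρ * (SL * (-k₁)) := mul_nonneg hρ0.le (mul_nonneg hSL.le (by linarith))
    -- Both correction terms are nonnegative, so a tie `ρ = 1 - q` makes each vanish.
    have h3 : ρ = 1 - q + SL * (κ + k₂) + ρ * (SL * (-k₁)) := by
      rw [hq_def]
      linear_combination hρ
    obtain ⟨h4, h5⟩ := of_ratio ρ hF (Or.inr (by linarith))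
    refine ⟨h4, fun h _ => ?_⟩
    have h6 : ρ = 1 - q := by
      rcases h5 h with h | h
      · linarith
      · exact h
    have h7 : SL * (κ + k₂) = 0 := by linarith
    have h8 : ρ * (SL * (-k₁)) = 0 := by linarith
    simp only [mul_eq_zero, hSL.ne', hρ0.ne', false_or] at h7 h8
    constructor <;> linarith
  have hbal : κ * (SL + SU) = 1 := hk.resolve_left hk₂
  rcases familyPoA_lower_bound (k₁ := k₁) (k₂ := k₂) (right_mem_Icc.2 hSU) with
    h | ⟨ρ', hρ'0, hρ'1, hα', hρ', hF'⟩
  · exact of_one h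
  -- Balance means `1 - q = κ * SU`. By `hgap`, `ρ < 1 - q` at `SL` forces `ρ' < q` at `SU`: leaving
  -- one end of the interval overshoots the other.
  have hlow : (ρ - (1 - q)) * (1 + SL * k₁) = SL * (κ + k₂ - κ * SU * k₁) := by
    rw [hq_def]
    linear_combination hρ + SL * k₁ * hbal
  have hhigh : (ρ' - q) * (1 + SU * k₁) = SU * (κ + k₂ - κ * SL * k₁) := by
    rw [hq_def]
    linear_combination hρ' + (-1 : ℝ) * hbal
  have hSU0 : 0 < SU := hSL.trans_le hSU
  have hgap : κ * SU * k₁ ≤ κ * SL * k₁ :=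
    mul_le_mul_of_nonpos_right (mul_le_mul_of_nonneg_left hSU hκ.le) hk₁
  rcases le_or_gt (1 - q) ρ with hc | hc
  · obtain ⟨h4, h5⟩ := of_ratio ρ hF (Or.inr hc)
    refine ⟨h4, fun h hlt => ?_⟩
    have hlt := hlt.resolve_left hk₂
    have h6 : ρ = 1 - q := by
      rcases h5 h with h | h
      · linarith
      · exact h
    rw [h6, sub_self, zero_mul, eq_comm, mul_eq_zero, or_iff_right hSL.ne'] at hlow
    have h7 : ρ' ≤ q := by
      have : (ρ' - q) * (1 + SU * k₁) ≤ 0 := by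
        rw [hhigh]
        exact mul_nonpos_of_nonneg_of_nonpos hSU0.le (by linarith)
      linarith [nonpos_of_mul_nonpos_left this hα']
    have h8 : ρ' = q := by
      rcases (of_ratio ρ' hF' (Or.inl h7)).2 h with h | h
      · exact h
      · linarith
    rw [h8, sub_self, zero_mul, eq_comm, mul_eq_zero, or_iff_right hSU0.ne'] at hhigh
    -- Ties at both sensitivities are two linear equations in `k₁, k₂`, independent exactly when `SL
    -- ≠ SU`.
    have h9 : k₁ * (κ * (SU - SL)) = 0 := by linarith
    have h10 : k₁ = 0 :=
      (mul_eq_zero.1 h9).resolve_right (mul_pos hκ (sub_pos.2 hlt)).ne'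
    rw [h10] at hlow
    exact ⟨h10, by linarith⟩
  · have h6 : κ + k₂ - κ * SU * k₁ < 0 := by
      have : SL * (κ + k₂ - κ * SU * k₁) < 0 := hlow ▸ mul_neg_of_neg_of_pos (by linarith) hα
      exact (pos_iff_neg_of_mul_neg this).1 hSL
    have h7 : ρ' < q := by
      have : (ρ' - q) * (1 + SU * k₁) < 0 := by
        rw [hhigh]
        exact mul_neg_of_pos_of_neg hSU0 (by linarith)
      linarith [(pos_iff_neg_of_mul_neg (mul_comm (ρ' - q) _ ▸ this)).1 hα']
    obtain ⟨h4, h5⟩ := of_ratio ρ' hF' (Or.inl h7.le)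
    exact ⟨h4, fun h _ => by rcases h5 h with h | h <;> linarith⟩

theorem proposition4 (SL SU β : ℝ) (hSL : 0 < SL) (hSU : SL ≤ SU) (hβ : 0 < β) :
    ((0 : ℝ), -min β (1 / (SL + SU))) ∈ optimalSubsidyCoeffs SL SU β ∧
    (SL < SU ∨ β ≤ 1 / (SL + SU) →
      optimalSubsidyCoeffs SL SU β = {((0 : ℝ), -min β (1 / (SL + SU)))}) ∧
    ∀ G ∈ parallelAffineGames,
      (β < 1 / (SL + SU) →
        G.poa SL SU (affineMechanism 0 (-min β (1 / (SL + SU)))) ≤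
          ENNReal.ofReal (4 / 3 * (1 - β * SL * (1 - β * SL)))) ∧
      (1 / (SL + SU) ≤ β →
        G.poa SL SU (affineMechanism 0 (-min β (1 / (SL + SU)))) ≤
          ENNReal.ofReal (4 / 3 * (1 - SL / SU / (1 + SL / SU) ^ 2))) := by
  have hS : 0 < SL + SU := by linarith
  set κ := min β (1 / (SL + SU)) with hκ_def
  have hκ : 0 < κ := lt_min hβ (one_div_pos.2 hS)
  have hκβ : κ ≤ β := min_le_left _ _
  have hκ' : κ * (SL + SU) ≤ 1 := (le_div_iff₀ hS).1 (min_le_right _ _)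
  have hupper : familyPoA parallelAffineGames SL SU (affineMechanism 0 (-κ)) ≤
      ENNReal.ofReal (4 / 3 * (1 - κ * SL * (1 - κ * SL))) :=
    iSup₂_le fun G hG => ParallelGame.FullyUtilized.poa_le hG hSL hκ hκ'
  -- Either `κ = β` and the box itself gives `-κ ≤ k₂`, or `κ` is the balancing rate.
  have hcase : ∀ k : ℝ × ℝ, k ∈ Icc (-β) 0 ×ˢ Icc (-β) 0 →
      -κ ≤ k.2 ∨ κ * (SL + SU) = 1 := by
    intro k hk
    rcases min_choice β (1 / (SL + SU)) with h | h
    · left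
      rw [hκ_def, h]
      exact hk.2.1
    · right
      rw [hκ_def, h]
      exact one_div_mul_cancel hS.ne'
  have hlower := fun (k : ℝ × ℝ) (hk : k ∈ Icc (-β) 0 ×ˢ Icc (-β) 0) =>
    le_familyPoA_of_subsidy hSL hSU hκ hκ' hk.1.2 (hcase k hk)
  have hmem : ((0 : ℝ), -κ) ∈ optimalSubsidyCoeffs SL SU β :=
    ⟨⟨⟨by simpa using hβ.le, le_rfl⟩, by simpa using hκβ, by simpa using hκ.le⟩,
      fun k hk => hupper.trans (hlower k hk).1⟩
  refine ⟨hmem, fun huniq => ?_, fun G hG => ⟨fun hlt => ?_, fun hge => ?_⟩⟩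
  · refine Subset.antisymm (fun k hk => ?_) (singleton_subset_iff.2 hmem)
    have hk' : -κ ≤ k.2 ∨ SL < SU := by
      rcases huniq with h | h
      · exact Or.inr h
      · left
        rw [hκ_def, min_eq_left h]
        exact hk.1.2.1
    obtain ⟨h1, h2⟩ := (hlower k hk.1).2 ((hk.2 hmem.1).trans hupper) hk'
    exact Prod.ext h1 h2
  · have h := ParallelGame.FullyUtilized.poa_le hG hSL hκ hκ'
    have hκ_eq : κ = β := min_eq_left hlt.le
    rwa [hκ_eq] at h ⊢
  · have h := ParallelGame.FullyUtilized.poa_le hG hSL hκ hκ'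
    have hκ_eq : κ = 1 / (SL + SU) := min_eq_right hge
    have hSU0 : 0 < SU := hSL.trans_le hSU
    have heq : κ * SL * (1 - κ * SL) = SL / SU / (1 + SL / SU) ^ 2 := by
      rw [hκ_eq]
      field_simp
      ring
    rwa [heq] at h
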